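/- Let $\Sigma$ be a finite alphabet linearly ordered by $\prec$, with $\mathit{pre}_\prec(x)$, $\mathit{succ}_\prec(x)$ the immediate predecessor and successor of $x$ (and $\mathit{pre}_\prec(\min)=\min$, $\mathit{succ}_\prec(\max)=\max$). Let $|u|_\sigma$ be the number of occurrences of $\sigma$ in a finite word $u$. A letter $a$ is the (necessarily unique) median of $u$ if $$\sum_{\sigma\succ a}|u|_\sigma<\sum_{\sigma\preceq a}|u|_\sigma\quad\text{and}\quad\sum_{\sigma\prec a}|u|_\sigma<\sum_{\sigma\succeq a}|u|_\sigma .$$ Consider the following monitor (the median monitor) with a candidate register $x$ and counters $c_1,c_2,c_3,c_4,n,i$. On the first letter $\sigma$ it sets $x:=\sigma$, $c_1,c_2,c_3,c_4:=0$, $n:=2$, $i:=1$, and returns $x$. On each later letter $\sigma$ it executes in order: 1. if $i=1$: (if $c_1\ge c_2$ then $x:=\mathit{pre}_\prec(x)$); (if $c_3\ge c_4$ then $x:=\mathit{succ}_\prec(x)$); $c_1,c_2,c_3,c_4:=0$; 2. if $\sigma\prec x$ then $c_1:=c_1+1$; if $\sigma\succeq x$ then $c_2:=c_2+1$; if $\sigma\succ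 x$ then $c_3:=c_3+1$; if $\sigma\preceq x$ then $c_4:=c_4+1$; 3. if $i=n$ then $n:=n+1$ and $i:=1$, else $i:=i+1$; return $x$. **Theorem.** The median monitor limit-monitors the median over finite connected Markov chains. That is, let $(X_i)_{i\ge1}$ be a Markov chain on a finite state set $Q$ with any initial distribution and an irreducible transition matrix, let $\lambda:Q\to\Sigma$ be a labelling of the states, and let $w=\lambda(X_1)\lambda(X_2)\cdots$. Then almost surely, for every $a\in\Sigma$: if $a$ is the median of every sufficiently long prefix of $w$, then the monitor running on $w$ returns $a$ after every sufficiently long prefix of $w$. -/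

import Mathlib

open MeasureTheory
open scoped ENNReal

namespace FreqMonitor

/-! ### Words, statistics, and their limits -/

section Statistics

variable {A O : Type*}

/-- The prefix of length `n` of the infinite word `w 0, w 1, w 2, …`. -/
def pref (w : ℕ → A) (n : ℕ) : List A := (List.range n).map w

/-- A (partial) function on finite words converges to the value `v` over the infinite word `w`
if it is defined and equal to `v` on all sufficiently long prefixes of `w`. -/
def ConvergesTo (μ : List A → Option O) (w : ℕ → A) (v : O) : Prop :=
  ∃ n, ∀ n', n ≤ n' → μ (pref w n') = some v

end Statistics

/-! ### Monitors -/

/-- A (deterministic, register-based) monitor: `init` is run on the first letter, `next` on every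
later letter, and `output` is the value returned after each letter. -/
structure Monitor (A O : Type*) where
  State : Type*
  init : A → State
  next : State → A → State
  output : State → O

namespace Monitor

variable {A O : Type*}

/-- The value that the monitor returns after it has read a word (undefined on the empty word). -/
def eval (M : Monitor A O) : List A → Option O
  | [] => none
  | a :: u => some (M.output (u.foldl M.next (M.init a)))

/-- The monitor `M` limit-monitors the statistic `μ` over the random infinite word `w`: almost
surely, whenever the statistic converges to some value over the word, the output of the monitor
converges to the same value. -/
def LimitMonitors {Ω : Type*} [MeasurableSpace Ω] (M : Monitor A O) (μ : List A → Option O)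
    (P : Measure Ω) (w : ℕ → Ω → A) : Prop :=
  ∀ᵐ ω ∂P, ∀ v : O, ConvergesTo μ (fun i => w i ω) v → ConvergesTo M.eval (fun i => w i ω) v

end Monitor

/-! ### The median -/

section Median

variable {A : Type*} [LinearOrder A] [Fintype A]

/-- The letter `a` is the median of the word `u`. -/
def IsMedian (u : List A) (a : A) : Prop :=
  (∑ σ with a < σ, u.count σ) < (∑ σ with σ ≤ a, u.count σ) ∧
  (∑ σ with σ < a, u.count σ) < (∑ σ with a ≤ σ, u.count σ)

theorem IsMedian.le {u : List A} {a b : A} (ha : IsMedian u a) (hb : IsMedian u b) : b ≤ a := by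
  by_contra! h
  have h1 : (∑ σ with σ ≤ a, u.count σ) ≤ (∑ σ with σ < b, u.count σ) := by
    apply Finset.sum_le_sum_of_subset
    intro σ hσ
    simp only [Finset.mem_filter, Finset.mem_univ, true_and] at hσ ⊢
    exact lt_of_le_of_lt hσ h
  have h2 : (∑ σ with b ≤ σ, u.count σ) ≤ (∑ σ with a < σ, u.count σ) := by
    apply Finset.sum_le_sum_of_subset
    intro σ hσ
    simp only [Finset.mem_filter, Finset.mem_univ, true_and] at hσ ⊢
    exact lt_of_lt_of_le h hσ
  have h3 := ha.1
  have h4 := hb.2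
  omega

open Classical in
/-- The median statistic: the median of a word if it exists, undefined otherwise. -/
noncomputable def median (u : List A) : Option A :=
  if h : ∃ a, IsMedian u a then some h.choose else none

theorem median_eq_some_iff {u : List A} {a : A} : median u = some a ↔ IsMedian u a := by
  unfold median
  split_ifs with h
  · rw [Option.some_inj]
    constructor
    · rintro rfl
      exact h.choose_spec
    · intro ha
      exact le_antisymm (ha.le h.choose_spec) (h.choose_spec.le ha)
  · simp only [false_iff]
    exact fun ha => h ⟨a, ha⟩

end Median

/-! ### The median monitor -/

/-- The registers of the median monitor: the candidate `x`, four counters, the length `n` of the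
current chunk, and the position `i` in it. -/
structure MedianState (A : Type*) where
  x : A
  c₁ : ℕ
  c₂ : ℕ
  c₃ : ℕ
  c₄ : ℕ
  n : ℕ
  i : ℕ

namespace MedianState

variable {A : Type*} [LinearOrder A]

/-- `Init`: the first letter is the first candidate, and forms the first chunk. -/
def start (σ : A) : MedianState A :=
  { x := σ, c₁ := 0, c₂ := 0, c₃ := 0, c₄ := 0, n := 2, i := 1 }

/-- At the first position of a chunk, update the candidate and reset the counters. -/
def update [PredOrder A] [SuccOrder A] (s : MedianState A) : MedianState A :=
  if s.i = 1 then
    let x₁ := if s.c₁ ≥ s.c₂ then Order.pred s.x else s.x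
    let x₂ := if s.c₃ ≥ s.c₄ then Order.succ x₁ else x₁
    { s with x := x₂, c₁ := 0, c₂ := 0, c₃ := 0, c₄ := 0 }
  else s

/-- Compare the letter `σ` with the candidate and increment the counters. -/
def count (s : MedianState A) (σ : A) : MedianState A :=
  { s with
    c₁ := if σ < s.x then s.c₁ + 1 else s.c₁
    c₂ := if σ ≥ s.x then s.c₂ + 1 else s.c₂
    c₃ := if σ > s.x then s.c₃ + 1 else s.c₃
    c₄ := if σ ≤ s.x then s.c₄ + 1 else s.c₄ }

/-- Move to the next position; after the last position of a chunk, start a chunk that is longer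
by one. -/
def advance (s : MedianState A) : MedianState A :=
  if s.i = s.n then { s with n := s.n + 1, i := 1 } else { s with i := s.i + 1 }

/-- `Next`: the processing of every letter after the first. -/
def step [PredOrder A] [SuccOrder A] (s : MedianState A) (σ : A) : MedianState A :=
  (s.update.count σ).advance

end MedianState

/-- The median monitor. On a finite linear order `Order.pred x` and `Order.succ x` are the
immediate predecessor and successor of `x`, with `Order.pred ⊥ = ⊥` and `Order.succ ⊤ = ⊤`. -/
def medianMonitor (A : Type*) [LinearOrder A] [PredOrder A] [SuccOrder A] : Monitor A A where
  State := MedianState A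
  init := MedianState.start
  next := MedianState.step
  output := MedianState.x

/-! ### Labelled Markov chains -/

/-- A Markov chain with state space `Q` whose states are labelled by letters in `A`. -/
structure MarkovChain (Q A : Type*) where
  init : PMF Q
  trans : Q → PMF Q
  label : Q → A

namespace MarkovChain

variable {Q A : Type*}

/-- The chain is connected (irreducible): every state can be reached from every state along
transitions of positive probability. -/
def Connected (M : MarkovChain Q A) : Prop :=
  ∀ p q : Q, Relation.ReflTransGen (fun r r' => M.trans r r' ≠ 0) p q

/-- The state process `X 0, X 1, …` is `Markov(M)`: the law of `X 0` is the initial distribution,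
and, given any history of positive probability that ends in state `q n`, the next state is
`q (n + 1)` with probability `M.trans (q n) (q (n + 1))`. -/
structure IsMarkov {Ω : Type*} [MeasurableSpace Ω] [MeasurableSpace Q] (M : MarkovChain Q A)
    (P : Measure Ω) (X : ℕ → Ω → Q) : Prop where
  measurable : ∀ i, Measurable (X i)
  init_law : ∀ q : Q, P {ω | X 0 ω = q} = M.init q
  step_law : ∀ (n : ℕ) (q : ℕ → Q),
    P {ω | ∀ i ≤ n + 1, X i ω = q i} = P {ω | ∀ i ≤ n, X i ω = q i} * M.trans (q n) (q (n + 1))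

end MarkovChain

end FreqMonitor

namespace FreqMonitor

open Filter Topology

namespace MarkovChain

/-! ### The transition operator and its Poisson equation -/

/-! A letter `a` is the median of a word exactly when two functions of the letters have positive
sums over it: the indicator of `σ ≤ a` minus that of `a < σ`, and the indicator of `a ≤ σ` minus
that of `σ < a`. So it suffices to show, for any `f : Q → ℝ`, that almost surely eventual positivity
of the prefix sums of `f` passes to its sums over all late chunks
(`IsMarkov.ae_eventually_sum_pos_of_eventually_sum_pos`).

Solving the Poisson equation `f = c + g - P g` writes a sum of `f` over `n` steps as `n * c`, plus a
bounded term, plus a martingale with bounded increments. The sign of the constant `c` decides. If `c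
> 0`, an exponential-moment bound makes the probability that a window of length `n` has a
nonpositive sum decay geometrically, uniformly in where the window starts; Borel–Cantelli applies
because the chunk lengths are distinct. If `c ≤ 0`, the premise almost surely fails. Eventually
positive sums would bound the martingale below, hence make it converge; its increments would tend to
zero, yet every possible transition recurs, so all increments vanish and the sum is at most zero at
each return to the initial state. This also covers `c = 0`, where a law of large numbers would say
nothing.

The rest is deterministic: once `a` is the median of every late chunk, each chunk moves the
candidate one step towards `a` and then keeps it there. -/

theorem trans_toReal_pos {Q A : Type*} (M : MarkovChain Q A) {q r : Q} (h : M.trans q r ≠ 0) :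
    0 < (M.trans q r).toReal :=
  ENNReal.toReal_pos h ((M.trans q).apply_ne_top r)

section Poisson

variable {Q A : Type*} [Fintype Q] (M : MarkovChain Q A)

/-- The transition operator: the expected value of `g` after one step from `q`. -/
noncomputable def avg (g : Q → ℝ) (q : Q) : ℝ := ∑ r, (M.trans q r).toReal * g r

theorem sum_trans_toReal (q : Q) : ∑ r, (M.trans q r).toReal = 1 := by
  rw [← ENNReal.toReal_sum fun r _ => (M.trans q).apply_ne_top r,
    ← tsum_fintype (L := .unconditional _),
    (M.trans q).tsum_coe, ENNReal.toReal_one]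

theorem sub_avg_eq (g : Q → ℝ) (q : Q) :
    g q - M.avg g q = ∑ r, (M.trans q r).toReal * (g q - g r) := by
  simp only [mul_sub, Finset.sum_sub_distrib, ← Finset.sum_mul, M.sum_trans_toReal, one_mul, avg]

theorem avg_le_of_forall_le {g : Q → ℝ} {c : ℝ} (h : ∀ r, g r ≤ c) (q : Q) : M.avg g q ≤ c := by
  calc M.avg g q ≤ ∑ r, (M.trans q r).toReal * c :=
        Finset.sum_le_sum fun r _ => mul_le_mul_of_nonneg_left (h r) ENNReal.toReal_nonneg
    _ = c := by rw [← Finset.sum_mul, M.sum_trans_toReal, one_mul]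

theorem le_avg_of_forall_le {g : Q → ℝ} {c : ℝ} (h : ∀ r, c ≤ g r) (q : Q) : c ≤ M.avg g q := by
  calc c = ∑ r, (M.trans q r).toReal * c := by
        rw [← Finset.sum_mul, M.sum_trans_toReal, one_mul]
    _ ≤ M.avg g q :=
        Finset.sum_le_sum fun r _ => mul_le_mul_of_nonneg_left (h r) ENNReal.toReal_nonneg

/-- `g ↦ g - P g + g q₀`, an endomorphism that is invertible if the chain is connected. -/
noncomputable def poissonMap (q₀ : Q) : (Q → ℝ) →ₗ[ℝ] (Q → ℝ) where
  toFun g q := g q - M.avg g q + g q₀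
  map_add' g h := by
    ext q
    simp only [avg, Pi.add_apply, mul_add, Finset.sum_add_distrib]
    ring
  map_smul' c g := by
    ext q
    simp only [avg, Pi.smul_apply, smul_eq_mul, RingHom.id_apply, mul_add, mul_sub, Finset.mul_sum]
    simp only [mul_left_comm]

/-- The maximum principle: harmonic functions of a connected chain are constant. -/
theorem Connected.eq_of_avg_eq {M : MarkovChain Q A} (hM : M.Connected) {g : Q → ℝ}
    (hg : ∀ q, M.avg g q = g q) (p q : Q) : g p = g q := by
  have : Nonempty Q := ⟨p⟩
  obtain ⟨m, hm⟩ := Finite.exists_max g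
  have key : ∀ r, g r = g m := by
    intro r
    induction hM m r with
    | refl => rfl
    | @tail b c _ hbc ih =>
      -- At a maximum all terms of this vanishing sum are nonnegative, so each vanishes.
      have h0 : ∑ r, (M.trans b r).toReal * (g b - g r) = 0 := by
        rw [← M.sub_avg_eq, hg, sub_self]
      have h1 := (Finset.sum_eq_zero_iff_of_nonneg fun r _ =>
        mul_nonneg ENNReal.toReal_nonneg (sub_nonneg.2 (ih ▸ hm r))).1 h0 c (Finset.mem_univ c)
      have h2 := (mul_eq_zero.1 h1).resolve_left (M.trans_toReal_pos hbc).ne'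
      linarith
  rw [key p, key q]

/-- The Poisson equation of a connected chain is solvable: every function differs by a constant
from a function of the form `g - P g`. -/
theorem Connected.exists_poisson {M : MarkovChain Q A} (hM : M.Connected) [Nonempty Q]
    (f : Q → ℝ) : ∃ (c : ℝ) (g : Q → ℝ), ∀ q, f q = c + (g q - M.avg g q) := by
  obtain ⟨q₀⟩ := ‹Nonempty Q›
  have : Nonempty Q := ⟨q₀⟩
  have hinj : Function.Injective (M.poissonMap q₀) := by
    rw [← LinearMap.ker_eq_bot, LinearMap.ker_eq_bot']
    intro g hg
    have hg' : ∀ q, g q - M.avg g q + g q₀ = 0 := fun q => congrFun hg q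
    obtain ⟨m, hm⟩ := Finite.exists_max g
    obtain ⟨l, hl⟩ := Finite.exists_min g
    -- `g - P g` is the constant `-g q₀`, but it is nonnegative at a maximum of `g` and nonpositive
    -- at a minimum. So `g q₀ = 0`, and `g` is harmonic, hence constant.
    have h1 := M.avg_le_of_forall_le hm m
    have h2 := M.le_avg_of_forall_le hl l
    have h3 : g q₀ = 0 := by linarith [hg' m, hg' l]
    funext q
    rw [hM.eq_of_avg_eq (g := g) (fun q => by linarith [hg' q]) q q₀, h3, Pi.zero_apply]
  obtain ⟨g, hg⟩ := LinearMap.injective_iff_surjective.1 hinj f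
  refine ⟨g q₀, g, fun q => ?_⟩
  rw [← hg]
  exact add_comm _ _

/-- Martingale decomposition of the partial sums of `f = c + g - P g`. -/
theorem sum_eq_of_poisson {M : MarkovChain Q A} {f g : Q → ℝ} {c : ℝ}
    (h : ∀ q, f q = c + (g q - M.avg g q))
    (x : ℕ → Q) (s n : ℕ) :
    ∑ i ∈ Finset.range n, f (x (s + i)) = n * c + g (x s) - g (x (s + n)) +
      ∑ i ∈ Finset.range n, (g (x (s + i + 1)) - M.avg g (x (s + i))) := by
  induction n with
  | zero => simp
  | succ n ih =>
    rw [Finset.sum_range_succ, Finset.sum_range_succ, ih, h]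
    push_cast
    rw [← add_assoc s n 1]
    ring

theorem exists_abs_sub_avg_le (g : Q → ℝ) :
    ∃ K : ℝ, 0 < K ∧ (∀ q r, |g q - g r| ≤ K) ∧ ∀ q r, |g q - M.avg g r| ≤ K := by
  obtain ⟨K, hK⟩ := (Set.finite_range fun q => |g q|).bddAbove
  have hK' : ∀ q, |g q| ≤ K := fun q => hK ⟨q, rfl⟩
  have h1 : ∀ q, M.avg g q ≤ K := M.avg_le_of_forall_le fun r => (abs_le.1 (hK' r)).2
  have h2 : ∀ q, -K ≤ M.avg g q := M.le_avg_of_forall_le fun r => (abs_le.1 (hK' r)).1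
  -- The maximum with `1` keeps the bound strictly positive, so that it can be divided by.
  refine ⟨max (2 * K) 1, by positivity, fun q r => le_max_of_le_left ?_,
    fun q r => le_max_of_le_left ?_⟩
  · have := abs_le.1 (hK' q); have := abs_le.1 (hK' r)
    exact abs_le.2 ⟨by linarith, by linarith⟩
  · have := abs_le.1 (hK' q); have := h1 r; have := h2 r
    exact abs_le.2 ⟨by linarith, by linarith⟩

/-- For `|u| ≤ 1` one has `exp u ≤ 1 + u + u ^ 2`. With `u = t * (g r - M.avg g q)` the linear term
averages to zero, and `1 + v ≤ exp v` absorbs the quadratic one. -/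
theorem avg_exp_le {g : Q → ℝ} {K t : ℝ}
    (hK : ∀ q r, |g q - M.avg g r| ≤ K) (ht : |t| * K ≤ 1) (q : Q) :
    M.avg (fun r => Real.exp (t * g r)) q ≤
      Real.exp (t * M.avg g q) * Real.exp ((|t| * K) ^ 2) := by
  have h1 : ∀ r, Real.exp (t * g r) ≤
      Real.exp (t * M.avg g q) * (1 + t * (g r - M.avg g q) + (|t| * K) ^ 2) := by
    intro r
    have h2 : |t * (g r - M.avg g q)| ≤ |t| * K := by
      rw [abs_mul]
      exact mul_le_mul_of_nonneg_left (hK r q) (abs_nonneg t)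
    have h3 := (abs_le.1 (Real.abs_exp_sub_one_sub_id_le (h2.trans ht))).2
    have h4 : (t * (g r - M.avg g q)) ^ 2 ≤ (|t| * K) ^ 2 := by
      rw [← sq_abs]
      exact pow_le_pow_left₀ (abs_nonneg _) h2 2
    calc Real.exp (t * g r) = Real.exp (t * M.avg g q) * Real.exp (t * (g r - M.avg g q)) := by
          rw [← Real.exp_add]; ring_nf
      _ ≤ _ := mul_le_mul_of_nonneg_left (by linarith) (Real.exp_nonneg _)
  have h5 : ∑ r, (M.trans q r).toReal * (g r - M.avg g q) = 0 := by
    simp only [mul_sub, Finset.sum_sub_distrib, ← Finset.sum_mul, M.sum_trans_toReal, one_mul]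
    exact sub_self _
  calc M.avg (fun r => Real.exp (t * g r)) q
      ≤ ∑ r, (M.trans q r).toReal *
          (Real.exp (t * M.avg g q) * (1 + t * (g r - M.avg g q) + (|t| * K) ^ 2)) :=
        Finset.sum_le_sum fun r _ => mul_le_mul_of_nonneg_left (h1 r) ENNReal.toReal_nonneg
    _ = Real.exp (t * M.avg g q) * ((1 + (|t| * K) ^ 2) * ∑ r, (M.trans q r).toReal +
          t * ∑ r, (M.trans q r).toReal * (g r - M.avg g q)) := by
        rw [Finset.mul_sum, Finset.mul_sum, ← Finset.sum_add_distrib, Finset.mul_sum]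
        exact Finset.sum_congr rfl fun r _ => by ring
    _ ≤ _ := by
        rw [h5, M.sum_trans_toReal]
        refine mul_le_mul_of_nonneg_left ?_ (Real.exp_nonneg _)
        linarith [Real.add_one_le_exp ((|t| * K) ^ 2)]

end Poisson

end MarkovChain

namespace MarkovChain

/-! ### The filtration of the past and the Markov property -/

section Past

variable {Q Ω : Type*} [MeasurableSpace Q] {mΩ : MeasurableSpace Ω}

/-- The filtration of the past of the process `X`: the `n`-th σ-algebra is generated by the path
`X 0, …, X n`. -/
def past (X : ℕ → Ω → Q) (hX : ∀ i, Measurable (X i)) : Filtration ℕ mΩ where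
  seq n := MeasurableSpace.comap (fun ω (i : Fin (n + 1)) => X i ω) MeasurableSpace.pi
  mono' m n hmn := by
    have : (fun ω (i : Fin (m + 1)) => X i ω) =
        (fun (r : Fin (n + 1) → Q) (i : Fin (m + 1)) => r (Fin.castLE (by omega) i)) ∘
          (fun ω (i : Fin (n + 1)) => X i ω) := rfl
    dsimp only
    rw [this, ← MeasurableSpace.comap_comp]
    exact MeasurableSpace.comap_mono
      (measurable_pi_lambda _ fun i => measurable_pi_apply _).comap_le
  le' n := (measurable_pi_lambda _ fun i => hX _).comap_le

theorem measurable_past {X : ℕ → Ω → Q} (hX : ∀ i, Measurable (X i)) {i n : ℕ} (hi : i ≤ n) :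
    Measurable[past X hX n] (X i) := by
  have h : Measurable[past X hX n] (fun ω (i : Fin (n + 1)) => X i ω) := comap_measurable _
  exact (measurable_pi_apply (⟨i, by omega⟩ : Fin (n + 1))).comp h

end Past

/-- Almost surely, a chain takes only transitions of positive probability. -/
theorem IsMarkov.ae_trans_ne_zero {Q A Ω : Type*} [Finite Q] [MeasurableSpace Q]
    {mΩ : MeasurableSpace Ω} {M : MarkovChain Q A} {P : Measure Ω} {X : ℕ → Ω → Q}
    (hX : M.IsMarkov P X) :
    ∀ᵐ ω ∂P, ∀ n, M.trans (X n ω) (X (n + 1) ω) ≠ 0 := by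
  rw [ae_all_iff]
  intro n
  have h1 : ∀ r : Fin (n + 2) → Q, ∀ᵐ ω ∂P, (∀ i : Fin (n + 2), X i ω = r i) →
      M.trans (X n ω) (X (n + 1) ω) ≠ 0 := by
    intro r
    by_cases h0 : M.trans (r ⟨n, by omega⟩) (r ⟨n + 1, by omega⟩) = 0
    · have h2 := hX.step_law n fun i => if h : i < n + 2 then r ⟨i, h⟩ else r 0
      simp only [show n < n + 2 by omega, show n + 1 < n + 2 by omega, dif_pos, h0, mul_zero] at h2
      rw [measure_eq_zero_iff_ae_notMem] at h2
      filter_upwards [h2] with ω hω hω'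
      refine absurd ?_ hω
      intro i hi
      simpa [show i < n + 2 by omega] using hω' ⟨i, by omega⟩
    · refine Eventually.of_forall fun ω hω => ?_
      have e1 := hω ⟨n, by omega⟩
      have e2 := hω ⟨n + 1, by omega⟩
      simp only at e1 e2
      rwa [e1, e2]
  filter_upwards [ae_all_iff.2 h1] with ω hω
  exact hω (fun i => X i ω) fun i => rfl

variable {Q A Ω : Type*} [Fintype Q] [MeasurableSpace Q] [DiscreteMeasurableSpace Q]
  {mΩ : MeasurableSpace Ω} {M : MarkovChain Q A} {P : Measure Ω} [IsProbabilityMeasure P]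
  {X : ℕ → Ω → Q}

theorem stronglyMeasurable_past (hX : ∀ i, Measurable (X i)) (φ : Q → ℝ) {i n : ℕ} (hi : i ≤ n) :
    StronglyMeasurable[past X hX n] (fun ω => φ (X i ω)) :=
  ((measurable_of_finite φ).comp (measurable_past hX hi)).stronglyMeasurable

theorem integrable_comp_of_finite {Y : Ω → Q} (hY : Measurable Y) (φ : Q → ℝ) :
    Integrable (fun ω => φ (Y ω)) P :=
  (Integrable.of_finite (μ := P.map Y) (f := φ)).comp_measurable hY

theorem setIntegral_comp_of_finite {Y : Ω → Q} (hY : Measurable Y) (φ : Q → ℝ) (E : Set Ω) :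
    ∫ ω in E, φ (Y ω) ∂P = ∑ q, P.real (E ∩ {ω | Y ω = q}) * φ q := by
  rw [← integral_map (φ := Y) (f := φ) hY.aemeasurable
    (measurable_of_finite φ).aestronglyMeasurable, integral_fintype .of_finite]
  refine Finset.sum_congr rfl fun q _ => ?_
  rw [smul_eq_mul, measureReal_def, measureReal_def, Measure.map_apply hY (.of_discrete),
    Measure.restrict_apply (hY .of_discrete), Set.inter_comm]
  rfl

/-- This is the Markov property on a single path cylinder, where `X n` is constant; such cylinders
are the building blocks of the past σ-algebra. -/
theorem IsMarkov.setIntegral_path (hX : M.IsMarkov P X) (φ : Q → ℝ) (n : ℕ) (r : Fin (n + 1) → Q) :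
    ∫ ω in {ω | ∀ i : Fin (n + 1), X i ω = r i}, M.avg φ (X n ω) ∂P =
      ∫ ω in {ω | ∀ i : Fin (n + 1), X i ω = r i}, φ (X (n + 1) ω) ∂P := by
  have hE : MeasurableSet {ω | ∀ i : Fin (n + 1), X i ω = r i} := by
    simp only [Set.ofPred_forall]
    exact MeasurableSet.iInter fun i => hX.measurable _ (.of_discrete (s := {r i}))
  rw [setIntegral_comp_of_finite (hX.measurable _) φ]
  have h1 : ∫ ω in {ω | ∀ i : Fin (n + 1), X i ω = r i}, M.avg φ (X n ω) ∂P =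
      ∫ ω in {ω | ∀ i : Fin (n + 1), X i ω = r i}, M.avg φ (r (Fin.last n)) ∂P := by
    refine setIntegral_congr_fun hE fun ω hω => ?_
    have := hω (Fin.last n)
    simp only [Fin.val_last] at this
    simp only [this]
  rw [h1, setIntegral_const, smul_eq_mul, avg, Finset.mul_sum]
  refine Finset.sum_congr rfl fun q _ => ?_
  rw [← mul_assoc]
  congr 1
  -- Here the default value matters: it prescribes the state `q` at time `n + 1`.
  have h2 := hX.step_law n fun i => if h : i < n + 1 then r ⟨i, h⟩ else q
  have e1 : {ω | ∀ i ≤ n, X i ω = if h : i < n + 1 then r ⟨i, h⟩ else q} =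
      {ω | ∀ i : Fin (n + 1), X i ω = r i} := by
    ext ω
    constructor
    · intro h i
      exact (h i (by omega)).trans (dif_pos i.2)
    · intro h i hi
      simpa [show i < n + 1 by omega] using h ⟨i, by omega⟩
  have e2 : {ω | ∀ i ≤ n + 1, X i ω = if h : i < n + 1 then r ⟨i, h⟩ else q} =
      {ω | ∀ i : Fin (n + 1), X i ω = r i} ∩ {ω | X (n + 1) ω = q} := by
    rw [← e1]
    ext ω
    constructor
    · intro h
      exact ⟨fun i hi => h i (by omega), by simpa using h (n + 1) le_rfl⟩
    · rintro ⟨h, h'⟩ i hi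
      rcases hi.eq_or_lt with rfl | hi
      · simpa using h'
      · exact h i (by omega)
  rw [e1, e2] at h2
  simp only [measureReal_def, h2, ENNReal.toReal_mul]
  simp [Fin.last]

/-- The Markov property. -/
theorem IsMarkov.condExp_comp (hX : M.IsMarkov P X) (φ : Q → ℝ) (n : ℕ) :
    P[fun ω => φ (X (n + 1) ω) | past X hX.measurable n] =ᵐ[P] fun ω => M.avg φ (X n ω) := by
  symm
  refine ae_eq_condExp_of_forall_setIntegral_eq ((past X hX.measurable).le n)
    (integrable_comp_of_finite (hX.measurable _) φ)
    (fun s _ _ => (integrable_comp_of_finite (hX.measurable _) (M.avg φ)).integrableOn) ?_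
    (stronglyMeasurable_past hX.measurable (M.avg φ) le_rfl).aestronglyMeasurable
  rintro s ⟨T, -, rfl⟩ -
  classical
  -- There are finitely many paths of length `n + 1`, so each event of the past is a finite disjoint
  -- union of path cylinders.
  have hs : (fun ω (i : Fin (n + 1)) => X i ω) ⁻¹' T =
      ⋃ r ∈ T.toFinset, {ω | ∀ i : Fin (n + 1), X i ω = r i} := by
    ext ω
    simp only [Set.mem_preimage, Set.mem_iUnion, Set.mem_toFinset, exists_prop, Set.mem_ofPred_eq]
    constructor
    · exact fun h => ⟨_, h, fun i => rfl⟩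
    · rintro ⟨r, hr, h⟩
      rwa [funext h]
  have hd : Set.Pairwise (T.toFinset : Set (Fin (n + 1) → Q))
      (Function.onFun Disjoint fun r => {ω | ∀ i : Fin (n + 1), X i ω = r i}) := by
    intro r _ r' _ hne
    refine Set.disjoint_left.2 fun ω h h' => hne (funext fun i => ?_)
    rw [← h i, ← h' i]
  have hE : ∀ r ∈ T.toFinset, MeasurableSet {ω | ∀ i : Fin (n + 1), X i ω = r i} := fun r _ => by
    simp only [Set.ofPred_forall]
    exact MeasurableSet.iInter fun i => hX.measurable _ (.of_discrete (s := {r i}))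
  rw [hs, integral_biUnion_finset _ hE hd fun r _ =>
      (integrable_comp_of_finite (hX.measurable _) (M.avg φ)).integrableOn,
    integral_biUnion_finset _ hE hd fun r _ =>
      (integrable_comp_of_finite (hX.measurable _) φ).integrableOn]
  exact Finset.sum_congr rfl fun r _ => hX.setIntegral_path φ n r

/-! ### Recurrence -/

theorem sum_indicator_tendsto_of_frequently {p : ℕ → Prop} [DecidablePred p]
    (h : ∃ᶠ n in atTop, p n) :
    Tendsto (fun n => ∑ k ∈ Finset.range n, if p k then (1 : ℝ) else 0) atTop atTop := by
  have h1 : ∀ n, ∑ k ∈ Finset.range n, (if p k then (1 : ℝ) else 0) = Nat.count p n := fun n => by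
    rw [Nat.count_eq_card_filter_range, Finset.sum_boole]
  simp only [h1]
  refine tendsto_natCast_atTop_atTop.comp (tendsto_atTop_atTop_of_monotone (Nat.count_monotone p) ?_)
  intro b
  exact ⟨Nat.nth p b, (Nat.count_nth_of_infinite (Nat.frequently_atTop_iff_infinite.1 h) b).ge⟩

/-- Almost surely, a transition of positive probability out of a state that is visited infinitely
often is taken infinitely often. -/
theorem IsMarkov.ae_frequently_transition (hX : M.IsMarkov P X) {q r : Q} (h : M.trans q r ≠ 0) :
    ∀ᵐ ω ∂P, (∃ᶠ n in atTop, X n ω = q) → ∃ᶠ n in atTop, X n ω = q ∧ X (n + 1) ω = r := by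
  classical
  have hm := hX.measurable
  -- The truncated `n - 1` distorts only `s 0`, which does not affect the limsup.
  let s : ℕ → Set Ω := fun n => {ω | X (n - 1) ω = q} ∩ {ω | X n ω = r}
  have hs : ∀ n, MeasurableSet[past X hm n] (s n) := fun n =>
    MeasurableSet.inter (measurable_past hm (by omega : n - 1 ≤ n) (.of_discrete (s := {q})))
      (measurable_past hm le_rfl (.of_discrete (s := {r})))
  have hc : ∀ n, P[(s (n + 1)).indicator (1 : Ω → ℝ) | past X hm n] =ᵐ[P]
      fun ω => (M.trans q r).toReal * (if X n ω = q then 1 else 0) := by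
    intro n
    have e : (s (n + 1)).indicator (1 : Ω → ℝ) =
        (fun ω => if X n ω = q then (1 : ℝ) else 0) *
          (fun ω => (fun x => if x = r then (1 : ℝ) else 0) (X (n + 1) ω)) := by
      ext ω
      simp only [s, Set.indicator_apply, Set.mem_inter_iff, Set.mem_ofPred_eq, Pi.mul_apply,
        Nat.add_sub_cancel, Pi.one_apply]
      split_ifs <;> simp_all
    have hi : Integrable ((s (n + 1)).indicator (1 : Ω → ℝ)) P :=
      (integrable_const 1).indicator ((past X hm).le _ _ (hs _))
    rw [e] at hi ⊢
    refine (condExp_mul_of_stronglyMeasurable_left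
      (stronglyMeasurable_past hm (fun x => if x = q then (1 : ℝ) else 0) le_rfl) hi
      (integrable_comp_of_finite (hm _) fun x => if x = r then (1 : ℝ) else 0)).trans ?_
    filter_upwards [hX.condExp_comp (fun x => if x = r then (1 : ℝ) else 0) n] with ω hω
    rw [Pi.mul_apply, hω]
    by_cases hq : X n ω = q <;> simp [hq, avg]
  -- Lévy's conditional Borel–Cantelli lemma: the conditional probabilities sum to `M.trans q r`
  -- times the number of visits to `q`, which diverges.
  filter_upwards [ae_mem_limsup_atTop_iff P hs, ae_all_iff.2 hc] with ω h1 h2 h3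
  have h4 : ω ∈ limsup s atTop := by
    rw [h1]
    simp only [h2, ← Finset.mul_sum]
    exact (sum_indicator_tendsto_of_frequently h3).const_mul_atTop (M.trans_toReal_pos h)
  rw [mem_limsup_iff_frequently_mem] at h4
  rw [frequently_atTop] at h4 ⊢
  intro N
  obtain ⟨n, hn, h5, h6⟩ := h4 (N + 1)
  refine ⟨n - 1, by omega, h5, ?_⟩
  rwa [show n - 1 + 1 = n by omega]

/-- Almost surely, a connected chain takes all transitions of positive probability infinitely
often. -/
theorem IsMarkov.ae_forall_frequently (hX : M.IsMarkov P X) (hM : M.Connected) :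
    ∀ᵐ ω ∂P, (∀ q, ∃ᶠ n in atTop, X n ω = q) ∧
      ∀ q r, M.trans q r ≠ 0 → ∃ᶠ n in atTop, X n ω = q ∧ X (n + 1) ω = r := by
  have h : ∀ᵐ ω ∂P, ∀ q r, M.trans q r ≠ 0 → (∃ᶠ n in atTop, X n ω = q) →
      ∃ᶠ n in atTop, X n ω = q ∧ X (n + 1) ω = r := by
    simp only [ae_all_iff]
    exact fun q r hqr => hX.ae_frequently_transition hqr
  filter_upwards [h] with ω hω
  have h1 : ∀ q, ∃ᶠ n in atTop, X n ω = q := by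
    obtain ⟨p, hp⟩ : ∃ p, ∃ᶠ n in atTop, X n ω = p := by
      by_contra! hne
      obtain ⟨n, hn⟩ := (eventually_all.2 hne).exists
      exact hn _ rfl
    intro q
    induction hM p q with
    | refl => exact hp
    | @tail b c _ hbc ih =>
      have h2 := hω b c hbc ih
      rw [frequently_atTop] at h2 ⊢
      intro N
      obtain ⟨n, hn, -, h3⟩ := h2 N
      exact ⟨n + 1, by omega, h3⟩
  exact ⟨h1, fun q r hqr => hω q r hqr (h1 q)⟩

end MarkovChain

namespace MarkovChain

/-! ### Additive functionals of a Markov chain -/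

section Additive

variable {Q A Ω : Type*} [Fintype Q] [MeasurableSpace Q] [DiscreteMeasurableSpace Q]
  {mΩ : MeasurableSpace Ω} {M : MarkovChain Q A} {P : Measure Ω} [IsProbabilityMeasure P]
  {X : ℕ → Ω → Q}

theorem stronglyMeasurable_sum_past (hX : ∀ i, Measurable (X i)) (M : MarkovChain Q A) (g : Q → ℝ)
    (s n : ℕ) : StronglyMeasurable[past X hX (s + n)] fun ω =>
      ∑ i ∈ Finset.range n, (g (X (s + i + 1) ω) - M.avg g (X (s + i) ω)) := by
  refine Finset.stronglyMeasurable_fun_sum _ fun i hi => ?_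
  have := Finset.mem_range.1 hi
  exact (stronglyMeasurable_past hX g (by omega)).sub
    (stronglyMeasurable_past hX (M.avg g) (by omega))

theorem IsMarkov.martingale (hX : M.IsMarkov P X) (g : Q → ℝ) :
    Martingale (fun n ω => ∑ i ∈ Finset.range n, (g (X (i + 1) ω) - M.avg g (X i ω)))
      (past X hX.measurable) P := by
  have hm := hX.measurable
  have hi : ∀ i, Integrable (fun ω => g (X (i + 1) ω) - M.avg g (X i ω)) P := fun i =>
    (integrable_comp_of_finite (hm _) g).sub (integrable_comp_of_finite (hm _) (M.avg g))
  refine martingale_of_condExp_sub_eq_zero_nat (fun n => ?_)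
    (fun n => integrable_finsetSum _ fun i _ => hi i) fun n => ?_
  · have := stronglyMeasurable_sum_past hm M g 0 n
    simp only [zero_add] at this
    exact this.mono ((past X hm).mono (Nat.zero_add n).le)
  · have e : ((fun ω => ∑ i ∈ Finset.range (n + 1), (g (X (i + 1) ω) - M.avg g (X i ω))) -
        fun ω => ∑ i ∈ Finset.range n, (g (X (i + 1) ω) - M.avg g (X i ω))) =
        (fun ω => g (X (n + 1) ω)) - fun ω => M.avg g (X n ω) := by
      ext ω
      simp only [Pi.sub_apply, Finset.sum_range_succ, add_sub_cancel_left]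
    rw [e]
    refine (condExp_sub (integrable_comp_of_finite (hm _) g)
      (integrable_comp_of_finite (hm _) (M.avg g)) _).trans ?_
    rw [condExp_of_stronglyMeasurable ((past X hm).le n)
      (stronglyMeasurable_past hm (M.avg g) le_rfl) (integrable_comp_of_finite (hm _) _)]
    filter_upwards [hX.condExp_comp g n] with ω hω
    rw [Pi.sub_apply, hω, sub_self, Pi.zero_apply]

/-- If the mean of `f` is not positive, then almost surely the partial sums of `f` are not
eventually positive. -/
theorem IsMarkov.ae_not_eventually_sum_pos (hX : M.IsMarkov P X) (hM : M.Connected) {f g : Q → ℝ}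
    {c : ℝ} (h : ∀ q, f q = c + (g q - M.avg g q)) (hc : c ≤ 0) :
    ∀ᵐ ω ∂P, ¬ ∀ᶠ n in atTop, 0 < ∑ i ∈ Finset.range n, f (X i ω) := by
  obtain ⟨K, hK0, hK1, hK2⟩ := M.exists_abs_sub_avg_le g
  have hb : ∀ᵐ ω ∂P, ∀ n, |∑ i ∈ Finset.range (n + 1), (g (X (i + 1) ω) - M.avg g (X i ω)) -
      ∑ i ∈ Finset.range n, (g (X (i + 1) ω) - M.avg g (X i ω))| ≤ (⟨K, hK0.le⟩ : NNReal) :=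
    Eventually.of_forall fun ω n => by
      rw [Finset.sum_range_succ, add_sub_cancel_left]
      exact hK2 _ _
  filter_upwards [(hX.martingale g).bddAbove_range_iff_bddBelow_range hb,
    (hX.martingale g).submartingale.bddAbove_iff_exists_tendsto hb, hX.ae_forall_frequently hM,
    hX.ae_trans_ne_zero] with ω h1 h2 h3 h4 h5
  have hsum := fun n => sum_eq_of_poisson h (fun i => X i ω) 0 n
  simp only [zero_add] at hsum
  have hbelow : BddBelow (Set.range fun n =>
      ∑ i ∈ Finset.range n, (g (X (i + 1) ω) - M.avg g (X i ω))) := by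
    refine IsBoundedUnder.bddBelow_range ⟨-K, ?_⟩
    rw [eventually_map]
    filter_upwards [h5] with n hn
    rw [hsum] at hn
    have := (abs_le.1 (hK1 (X 0 ω) (X n ω))).2
    have : (n : ℝ) * c ≤ 0 := mul_nonpos_of_nonneg_of_nonpos n.cast_nonneg hc
    linarith
  -- A martingale with bounded increments that is bounded on one side almost surely converges.
  obtain ⟨l, hl⟩ := h2.1 (h1.2 hbelow)
  have hlim : Tendsto (fun n => g (X (n + 1) ω) - M.avg g (X n ω)) atTop (𝓝 0) := by
    have := ((tendsto_add_atTop_iff_nat 1).2 hl).sub hl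
    simpa only [Finset.sum_range_succ, add_sub_cancel_left, sub_self] using this
  -- An increment depends only on the transition taken, and that transition recurs; a nonzero value
  -- would recur too, contradicting the limit zero.
  have hzero : ∀ n, g (X (n + 1) ω) - M.avg g (X n ω) = 0 := by
    intro n
    by_contra hne
    have hev := hlim.eventually_ne (Ne.symm hne)
    obtain ⟨m, ⟨e1, e2⟩, hm⟩ := ((h3.2 _ _ (h4 n)).and_eventually hev).exists
    rw [e1, e2] at hm
    exact hm rfl
  -- At a late return to the initial state the `g` terms cancel and the sum is `n * c ≤ 0`.
  obtain ⟨n, e, hn⟩ := ((h3.1 (X 0 ω)).and_eventually h5).exists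
  rw [hsum, e, Finset.sum_eq_zero fun i _ => hzero i] at hn
  have : (n : ℝ) * c ≤ 0 := mul_nonpos_of_nonneg_of_nonpos n.cast_nonneg hc
  linarith

/-- Exponential moments of the martingale increments. -/
theorem IsMarkov.integral_exp_le (hX : M.IsMarkov P X) {g : Q → ℝ} {K t : ℝ}
    (hK : ∀ q r, |g q - M.avg g r| ≤ K) (ht : |t| * K ≤ 1) (s n : ℕ) :
    Integrable (fun ω => Real.exp (t * ∑ i ∈ Finset.range n,
      (g (X (s + i + 1) ω) - M.avg g (X (s + i) ω)))) P ∧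
    ∫ ω, Real.exp (t * ∑ i ∈ Finset.range n,
      (g (X (s + i + 1) ω) - M.avg g (X (s + i) ω))) ∂P ≤ Real.exp ((|t| * K) ^ 2) ^ n := by
  have hm := hX.measurable
  have hsm : ∀ n, StronglyMeasurable[past X hm (s + n)] fun ω => Real.exp (t * ∑ i ∈ Finset.range n,
      (g (X (s + i + 1) ω) - M.avg g (X (s + i) ω))) := fun n =>
    Real.continuous_exp.comp_stronglyMeasurable
      ((stronglyMeasurable_sum_past hm M g s n).const_mul t)
  have hint : ∀ n, Integrable (fun ω => Real.exp (t * ∑ i ∈ Finset.range n,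
      (g (X (s + i + 1) ω) - M.avg g (X (s + i) ω)))) P := fun n => by
    refine Integrable.of_bound ((hsm n).mono ((past X hm).le _)).aestronglyMeasurable
      (Real.exp (|t| * (n * K))) (Eventually.of_forall fun ω => ?_)
    rw [Real.norm_eq_abs, Real.abs_exp, Real.exp_le_exp]
    refine (le_abs_self _).trans ?_
    rw [abs_mul]
    refine mul_le_mul_of_nonneg_left ((Finset.abs_sum_le_sum_abs _ _).trans ?_) (abs_nonneg t)
    refine (Finset.sum_le_card_nsmul _ _ K fun i _ => hK _ _).trans ?_
    rw [Finset.card_range, nsmul_eq_mul]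
  refine ⟨hint n, ?_⟩
  induction n with
  | zero => simp
  | succ n ih =>
    -- The factor known at time `s + n`; only `φ (X (s + n + 1))` remains to be averaged by the
    -- Markov property.
    let Z : Ω → ℝ := fun ω => Real.exp (t * ∑ i ∈ Finset.range n,
      (g (X (s + i + 1) ω) - M.avg g (X (s + i) ω))) * Real.exp (-(t * M.avg g (X (s + n) ω)))
    let φ : Q → ℝ := fun r => Real.exp (t * g r)
    have hZ : StronglyMeasurable[past X hm (s + n)] Z := (hsm n).mul
      (stronglyMeasurable_past hm (fun q => Real.exp (-(t * M.avg g q))) le_rfl)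
    have e : (fun ω => Real.exp (t * ∑ i ∈ Finset.range (n + 1),
        (g (X (s + i + 1) ω) - M.avg g (X (s + i) ω)))) = Z * fun ω => φ (X (s + n + 1) ω) := by
      ext ω
      simp only [Z, φ, Pi.mul_apply, ← Real.exp_add, Finset.sum_range_succ]
      ring_nf
    have hi := hint (n + 1)
    rw [e] at hi ⊢
    have h1 := (condExp_mul_of_stronglyMeasurable_left hZ hi
      (integrable_comp_of_finite (hm _) φ)).trans
        ((EventuallyEq.refl _ Z).mul (hX.condExp_comp φ (s + n)))
    rw [← integral_condExp ((past X hm).le (s + n)), integral_congr_ae h1]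
    calc ∫ ω, (Z * fun ω => M.avg φ (X (s + n) ω)) ω ∂P
        ≤ ∫ ω, Real.exp (t * ∑ i ∈ Finset.range n,
            (g (X (s + i + 1) ω) - M.avg g (X (s + i) ω))) * Real.exp ((|t| * K) ^ 2) ∂P := by
          refine integral_mono_ae (integrable_condExp.congr h1) ((hint n).mul_const _)
            (Eventually.of_forall fun ω => ?_)
          simp only [Pi.mul_apply, Z, mul_assoc]
          refine mul_le_mul_of_nonneg_left ?_ (Real.exp_nonneg _)
          refine (mul_le_mul_of_nonneg_left (M.avg_exp_le hK ht _) (Real.exp_nonneg _)).trans ?_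
          rw [← mul_assoc, ← Real.exp_add, neg_add_cancel, Real.exp_zero, one_mul]
      _ ≤ _ := by
          rw [integral_mul_const, pow_succ]
          exact mul_le_mul_of_nonneg_right ih (Real.exp_nonneg _)

/-- If the mean of `f` is positive, then almost surely the sums of `f` over late windows of
lengths `0, 1, 2, …` are positive, wherever these windows start. -/
theorem IsMarkov.ae_eventually_sum_pos (hX : M.IsMarkov P X) {f g : Q → ℝ} {c : ℝ}
    (h : ∀ q, f q = c + (g q - M.avg g q)) (hc : 0 < c) (s : ℕ → ℕ) :
    ∀ᵐ ω ∂P, ∀ᶠ n in atTop, 0 < ∑ i ∈ Finset.range n, f (X (s n + i) ω) := by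
  obtain ⟨K, hK0, hK1, hK2⟩ := M.exists_abs_sub_avg_le g
  -- `t * K ≤ 1` permits the exponential bound, and `t * K ^ 2 < c` makes the geometric ratio `exp
  -- ((t * K) ^ 2 - t * c)` less than `1`.
  obtain ⟨t, ht0, ht1, ht2⟩ : ∃ t : ℝ, 0 < t ∧ t * K ≤ 1 ∧ t * K ^ 2 < c := by
    refine ⟨min (1 / K) (c / (2 * K ^ 2)), by positivity, ?_, ?_⟩
    · calc _ ≤ 1 / K * K := mul_le_mul_of_nonneg_right (min_le_left _ _) hK0.le
        _ = 1 := by field_simp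
    · calc _ ≤ c / (2 * K ^ 2) * K ^ 2 :=
            mul_le_mul_of_nonneg_right (min_le_right _ _) (by positivity)
        _ = c / 2 := by field_simp
        _ < c := by linarith
  have habs : |(-t)| * K = t * K := by rw [abs_neg, abs_of_pos ht0]
  have hP : ∀ n, P {ω | ∑ i ∈ Finset.range n, f (X (s n + i) ω) ≤ 0} ≤
      ENNReal.ofReal (Real.exp (t * K) * Real.exp ((t * K) ^ 2 - t * c) ^ n) := by
    intro n
    obtain ⟨hint, hle⟩ := hX.integral_exp_le hK2 (t := -t) (habs.trans_le ht1) (s n) n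
    rw [habs] at hle
    have h1 := (mul_meas_ge_le_integral_of_nonneg
      (Eventually.of_forall fun ω => Real.exp_nonneg _) hint
      (Real.exp (t * (n * c - K)))).trans hle
    -- A nonpositive window sum forces the martingale part to be at most `K - n * c`; the Chernoff
    -- bound with parameter `-t` applies.
    refine (measure_mono (t := {ω | Real.exp (t * (n * c - K)) ≤ Real.exp (-t *
      ∑ i ∈ Finset.range n, (g (X (s n + i + 1) ω) - M.avg g (X (s n + i) ω)))})
      fun ω hω => ?_).trans ?_
    · have h2 : ∑ i ∈ Finset.range n, f (X (s n + i) ω) ≤ 0 := hω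
      rw [sum_eq_of_poisson h (fun i => X i ω)] at h2
      have h3 := (abs_le.1 (hK1 (X (s n) ω) (X (s n + n) ω))).1
      refine Real.exp_le_exp.2 ?_
      rw [neg_mul, ← mul_neg]
      exact mul_le_mul_of_nonneg_left (by linarith) ht0.le
    · rw [← ofReal_measureReal]
      refine ENNReal.ofReal_le_ofReal ?_
      rw [mul_comm, ← le_div_iff₀ (Real.exp_pos _)] at h1
      refine h1.trans_eq ?_
      rw [← Real.exp_nat_mul, ← Real.exp_nat_mul, ← Real.exp_sub, ← Real.exp_add]
      ring_nf
  have hsum : Summable fun n : ℕ => Real.exp (t * K) * Real.exp ((t * K) ^ 2 - t * c) ^ n := by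
    refine (summable_geometric_of_lt_one (Real.exp_nonneg _) (Real.exp_lt_one_iff.2 ?_)).mul_left _
    have := mul_lt_mul_of_pos_left ht2 ht0
    linarith [show (t * K) ^ 2 = t * (t * K ^ 2) by ring]
  have hfin : ∑' n, P {ω | ∑ i ∈ Finset.range n, f (X (s n + i) ω) ≤ 0} ≠ ∞ :=
    ne_top_of_le_ne_top hsum.tsum_ofReal_ne_top (ENNReal.tsum_le_tsum hP)
  filter_upwards [ae_eventually_notMem hfin] with ω hω
  filter_upwards [hω] with n hn
  exact not_le.1 hn

/-- Almost surely, if the partial sums of `f` are eventually positive, then so are its sums over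
windows of lengths `0, 1, 2, …`, wherever these windows start. -/
theorem IsMarkov.ae_eventually_sum_pos_of_eventually_sum_pos (hX : M.IsMarkov P X)
    (hM : M.Connected) (f : Q → ℝ) (s : ℕ → ℕ) :
    ∀ᵐ ω ∂P, (∀ᶠ n in atTop, 0 < ∑ i ∈ Finset.range n, f (X i ω)) →
      ∀ᶠ n in atTop, 0 < ∑ i ∈ Finset.range n, f (X (s n + i) ω) := by
  obtain ⟨ω₀⟩ := nonempty_of_isProbabilityMeasure P
  have : Nonempty Q := ⟨X 0 ω₀⟩
  obtain ⟨c, g, h⟩ := hM.exists_poisson f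
  rcases le_or_gt c 0 with hc | hc
  · filter_upwards [hX.ae_not_eventually_sum_pos hM h hc] with ω hω hω'
    exact absurd hω' hω
  · filter_upwards [hX.ae_eventually_sum_pos h hc s] with ω hω _
    exact hω

end Additive
end MarkovChain

/-! ### Runs of the median monitor -/

section Run

variable {A : Type*} [LinearOrder A] [PredOrder A] [SuccOrder A]

/-- The registers of the median monitor after the letters `w 0, …, w m`. -/
def medianRun (w : ℕ → A) : ℕ → MedianState A
  | 0 => MedianState.start (w 0)
  | m + 1 => (medianRun w m).step (w (m + 1))

theorem medianMonitor_eval_pref (w : ℕ → A) (m : ℕ) :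
    (medianMonitor A).eval (pref w (m + 1)) = some (medianRun w m).x := by
  have h : ∀ m, ((List.range m).map fun i => w (i + 1)).foldl MedianState.step
      (MedianState.start (w 0)) = medianRun w m := by
    intro m
    induction m with
    | zero => rfl
    | succ m ih => rw [List.range_succ, List.map_append, List.foldl_append, ih]; rfl
  have h' : pref w (m + 1) = w 0 :: (List.range m).map fun i => w (i + 1) := by
    simp [pref, List.range_succ_eq_map, Function.comp_def]
  rw [h']
  simp only [Monitor.eval, medianMonitor, h]

/-- The index of the last letter before chunk `k`, which has length `k + 2`. -/
def chunkStart (k : ℕ) : ℕ := ∑ j ∈ Finset.range k, (j + 2)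

theorem chunkStart_succ (k : ℕ) : chunkStart (k + 1) = chunkStart k + (k + 2) :=
  Finset.sum_range_succ _ _

theorem exists_eq_chunkStart_add (m : ℕ) : ∃ k, ∃ j < k + 2, m = chunkStart k + j := by
  induction m with
  | zero => exact ⟨0, 0, by omega, rfl⟩
  | succ m ih =>
    obtain ⟨k, j, hj, rfl⟩ := ih
    by_cases h : j + 1 < k + 2
    · exact ⟨k, j + 1, h, rfl⟩
    · exact ⟨k + 1, 0, by omega, by rw [chunkStart_succ]; omega⟩

theorem chunkStart_mono : Monotone chunkStart :=
  monotone_nat_of_le_succ fun k => by rw [chunkStart_succ]; omega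

/-- Inside a chunk the candidate is fixed and the counters compare the letters with it. -/
theorem medianRun_add {w : ℕ → A} {t k : ℕ} (hn : (medianRun w t).n = k + 2)
    (hi : (medianRun w t).i = 1) {j : ℕ} (hj : j < k + 2) :
    medianRun w (t + (j + 1)) =
      let y := (medianRun w t).update.x
      { x := y
        c₁ := Nat.count (fun i => w (t + 1 + i) < y) (j + 1)
        c₂ := Nat.count (fun i => w (t + 1 + i) ≥ y) (j + 1)
        c₃ := Nat.count (fun i => w (t + 1 + i) > y) (j + 1)
        c₄ := Nat.count (fun i => w (t + 1 + i) ≤ y) (j + 1)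
        n := if j + 1 = k + 2 then k + 3 else k + 2
        i := if j + 1 = k + 2 then 1 else j + 2 } := by
  induction j with
  | zero =>
    have : medianRun w (t + (0 + 1)) = (medianRun w t).step (w (t + 1)) := rfl
    rw [this]
    simp [MedianState.step, MedianState.count, MedianState.advance, MedianState.update, hi, hn,
      Nat.count_succ]
  | succ j ih =>
    have : medianRun w (t + (j + 1 + 1)) = (medianRun w (t + (j + 1))).step (w (t + (j + 1) + 1)) :=
      rfl
    have hne : j + 1 ≠ k + 2 := by omega
    have e : t + (j + 1) + 1 = t + 1 + (j + 1) := by omega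
    have hc : ∀ (p : ℕ → Prop) [DecidablePred p], Nat.count p (j + 1 + 1) =
        if p (j + 1) then Nat.count p (j + 1) + 1 else Nat.count p (j + 1) := fun p _ => by
      rw [Nat.count_succ]; split_ifs <;> rfl
    rw [this, ih (by omega), e]
    generalize (medianRun w t).update.x = y
    -- Past the first position of a chunk, `update` does nothing.
    have hi2 : j + 2 ≠ 1 := by omega
    simp only [hne, if_false, MedianState.step, MedianState.count, MedianState.advance,
      MedianState.update, hc, hi2]
    by_cases h : j + 1 + 1 = k + 2
    · rw [if_pos h, if_pos h, if_pos h]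
    · rw [if_neg h, if_neg h, if_neg h]

theorem medianRun_chunkStart (w : ℕ → A) (k : ℕ) :
    (medianRun w (chunkStart k)).n = k + 2 ∧ (medianRun w (chunkStart k)).i = 1 := by
  induction k with
  | zero => exact ⟨rfl, rfl⟩
  | succ k ih =>
    rw [chunkStart_succ, medianRun_add ih.1 ih.2 (j := k + 1) (by omega)]
    simp

/-- The candidate during chunk `k`. -/
def chunkCandidate (w : ℕ → A) (k : ℕ) : A := (medianRun w (chunkStart k)).update.x

theorem medianRun_x_of_chunk (w : ℕ → A) (k : ℕ) {j : ℕ} (hj : j < k + 2) :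
    (medianRun w (chunkStart k + (j + 1))).x = chunkCandidate w k := by
  rw [medianRun_add (medianRun_chunkStart w k).1 (medianRun_chunkStart w k).2 hj]
  rfl

theorem chunkCandidate_succ (w : ℕ → A) (k : ℕ) :
    chunkCandidate w (k + 1) =
      let y := chunkCandidate w k
      let u := fun i => w (chunkStart k + 1 + i)
      let x₁ := if Nat.count (fun i => u i < y) (k + 2) ≥ Nat.count (fun i => u i ≥ y) (k + 2)
        then Order.pred y else y
      if Nat.count (fun i => u i > y) (k + 2) ≥ Nat.count (fun i => u i ≤ y) (k + 2)
        then Order.succ x₁ else x₁ := by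
  have h : chunkCandidate w (k + 1) = (medianRun w (chunkStart (k + 1))).update.x := rfl
  rw [h, chunkStart_succ, medianRun_add (medianRun_chunkStart w k).1 (medianRun_chunkStart w k).2
    (j := k + 1) (by omega)]
  simp [MedianState.update, chunkCandidate]

theorem count_add_count_not (p : ℕ → Prop) [DecidablePred p] (n : ℕ) :
    Nat.count p n + Nat.count (fun i => ¬ p i) n = n := by
  induction n with
  | zero => simp
  | succ n ih => simp only [Nat.count_succ]; split_ifs <;> omega

/-- A chunk in which fewer than half of the letters are above `a`, and fewer than half are below
`a`, moves the candidate one step towards `a`. -/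
theorem chunkCandidate_succ_of_majority {w : ℕ → A} {k : ℕ} {a : A}
    (h₁ : Nat.count (fun i => a < w (chunkStart k + 1 + i)) (k + 2) <
      Nat.count (fun i => w (chunkStart k + 1 + i) ≤ a) (k + 2))
    (h₂ : Nat.count (fun i => w (chunkStart k + 1 + i) < a) (k + 2) <
      Nat.count (fun i => a ≤ w (chunkStart k + 1 + i)) (k + 2)) :
    (chunkCandidate w k = a → chunkCandidate w (k + 1) = a) ∧
    (a < chunkCandidate w k →
      chunkCandidate w (k + 1) = Order.pred (chunkCandidate w k)) ∧
    (chunkCandidate w k < a →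
      chunkCandidate w (k + 1) = Order.succ (chunkCandidate w k)) := by
  rw [chunkCandidate_succ]
  generalize chunkCandidate w k = y
  generalize hu : (fun i => w (chunkStart k + 1 + i)) = u
  replace hu : ∀ i, w (chunkStart k + 1 + i) = u i := fun i => congrFun hu i
  simp only [hu] at h₁ h₂
  -- Complementary counts add up to the chunk length, so each comparison becomes a question about
  -- half of it, settled by monotonicity in the threshold.
  have e₁ : ∀ x : A, Nat.count (fun i => u i < x) (k + 2) +
      Nat.count (fun i => x ≤ u i) (k + 2) = k + 2 := fun x => by
    simpa using count_add_count_not (fun i => u i < x) (k + 2)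
  have e₂ : ∀ x : A, Nat.count (fun i => x < u i) (k + 2) +
      Nat.count (fun i => u i ≤ x) (k + 2) = k + 2 := fun x => by
    simpa using count_add_count_not (fun i => x < u i) (k + 2)
  simp only [ge_iff_le, gt_iff_lt]
  refine ⟨?_, fun h => ?_, fun h => ?_⟩
  · rintro rfl
    rw [if_neg (by omega), if_neg (by omega)]
  · have m₁ : Nat.count (fun i => u i ≤ a) (k + 2) ≤ Nat.count (fun i => u i < y) (k + 2) :=
      Nat.count_mono_left fun i _ hi => lt_of_le_of_lt hi h
    have m₂ : Nat.count (fun i => y < u i) (k + 2) ≤ Nat.count (fun i => a < u i) (k + 2) :=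
      Nat.count_mono_left fun i _ hi => h.trans hi
    have := e₁ a; have := e₁ y; have := e₂ a; have := e₂ y
    rw [if_neg (by omega), if_pos (by omega)]
  · have m₁ : Nat.count (fun i => a ≤ u i) (k + 2) ≤ Nat.count (fun i => y < u i) (k + 2) :=
      Nat.count_mono_left fun i _ hi => lt_of_lt_of_le h hi
    have m₂ : Nat.count (fun i => u i < y) (k + 2) ≤ Nat.count (fun i => u i < a) (k + 2) :=
      Nat.count_mono_left fun i _ hi => lt_trans hi h
    have := e₁ a; have := e₁ y; have := e₂ a; have := e₂ y
    rw [if_pos (by omega), if_neg (by omega)]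

/-- If the letter `a` is the median of every late chunk, then the monitor converges to `a`. -/
theorem medianMonitor_convergesTo [Fintype A] {w : ℕ → A} {a : A}
    (h : ∀ᶠ k in atTop, Nat.count (fun i => a < w (chunkStart k + 1 + i)) (k + 2) <
        Nat.count (fun i => w (chunkStart k + 1 + i) ≤ a) (k + 2) ∧
      Nat.count (fun i => w (chunkStart k + 1 + i) < a) (k + 2) <
        Nat.count (fun i => a ≤ w (chunkStart k + 1 + i)) (k + 2)) :
    ConvergesTo (medianMonitor A).eval w a := by
  obtain ⟨K, hK⟩ := eventually_atTop.1 h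
  have step := fun k hk => chunkCandidate_succ_of_majority (hK k hk).1 (hK k hk).2
  have stay : ∀ k, K ≤ k → chunkCandidate w k = a → ∀ l, k ≤ l → chunkCandidate w l = a := by
    intro k hk e l hl
    induction l, hl using Nat.le_induction with
    | base => exact e
    | succ l hl ih => exact (step l (hk.trans hl)).1 ih
  -- The candidate strictly decreases without passing `a`, since `a < y` gives `a ≤ Order.pred y`.
  have down : ∀ y : A, ∀ k, K ≤ k → chunkCandidate w k = y → a ≤ y →
      ∃ l, K ≤ l ∧ chunkCandidate w l = a := by
    intro y
    induction y using WellFoundedLT.induction with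
    | ind y ih =>
      intro k hk e hay
      rcases hay.eq_or_lt with rfl | hlt
      · exact ⟨k, hk, e⟩
      · have h1 := (step k hk).2.1 (e ▸ hlt)
        rw [e] at h1
        exact ih _ (Order.pred_lt_of_not_isMin (not_isMin_of_lt hlt)) (k + 1) (by omega) h1
          (Order.le_pred_of_lt hlt)
  have up : ∀ y : A, ∀ k, K ≤ k → chunkCandidate w k = y → y ≤ a →
      ∃ l, K ≤ l ∧ chunkCandidate w l = a := by
    intro y
    induction y using WellFoundedGT.induction with
    | ind y ih =>
      intro k hk e hay
      rcases hay.eq_or_lt with rfl | hlt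
      · exact ⟨k, hk, e⟩
      · have h1 := (step k hk).2.2 (e ▸ hlt)
        rw [e] at h1
        exact ih _ (Order.lt_succ_of_not_isMax (not_isMax_of_lt hlt)) (k + 1) (by omega) h1
          (Order.succ_le_of_lt hlt)
  obtain ⟨l, hl, e⟩ : ∃ l, K ≤ l ∧ chunkCandidate w l = a :=
    (le_total a (chunkCandidate w K)).elim (down _ K le_rfl rfl) (up _ K le_rfl rfl)
  -- The first letter of chunk `l` has index `chunkStart l + 1`, so it ends the prefix of length
  -- `chunkStart l + 2`.
  refine ⟨chunkStart l + 2, fun n hn => ?_⟩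
  obtain ⟨k, j, hj, hm⟩ := exists_eq_chunkStart_add (n - 2)
  obtain rfl : n = chunkStart k + (j + 1) + 1 := by omega
  have hlk : l ≤ k := by
    by_contra! hlt
    have := chunkStart_mono (Nat.succ_le_of_lt hlt)
    rw [Nat.succ_eq_add_one, chunkStart_succ] at this
    omega
  rw [medianMonitor_eval_pref, medianRun_x_of_chunk w k hj, stay l hl e k hlk]

end Run

/-! ### The median of a prefix -/

theorem sum_count_pref {A : Type*} [LinearOrder A] [Fintype A] (w : ℕ → A) (p : A → Prop)
    [DecidablePred p] (n : ℕ) :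
    ∑ σ with p σ, (pref w n).count σ = Nat.count (fun i => p (w i)) n := by
  induction n with
  | zero => simp [pref]
  | succ n ih =>
    have e : pref w (n + 1) = pref w n ++ [w n] := by simp [pref, List.range_succ]
    simp only [e, List.count_append, Finset.sum_add_distrib, ih, Nat.count_succ,
      List.count_singleton, beq_iff_eq]
    congr 1
    rw [Finset.sum_ite_eq]
    simp

theorem sum_ite_sub_ite (p q : ℕ → Prop) [DecidablePred p] [DecidablePred q] (n : ℕ) :
    ∑ i ∈ Finset.range n, ((if p i then (1 : ℝ) else 0) - if q i then 1 else 0) =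
      Nat.count p n - Nat.count q n := by
  rw [Finset.sum_sub_distrib, Finset.sum_boole, Finset.sum_boole, Nat.count_eq_card_filter_range,
    Nat.count_eq_card_filter_range]

end FreqMonitor

open Filter in
theorem mainTheorem4 {A Q Ω : Type*} [LinearOrder A] [Fintype A] [PredOrder A] [SuccOrder A]
    [Finite Q] [MeasurableSpace Q] [DiscreteMeasurableSpace Q]
    (M : FreqMonitor.MarkovChain Q A) (hM : M.Connected)
    [MeasurableSpace Ω] (P : MeasureTheory.Measure Ω) [MeasureTheory.IsProbabilityMeasure P]
    (X : ℕ → Ω → Q) (hX : M.IsMarkov P X) :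
    (FreqMonitor.medianMonitor A).LimitMonitors FreqMonitor.median P
      (fun i ω => M.label (X i ω)) := by
  have := Fintype.ofFinite Q
  have key : ∀ (p q : A → Prop) [DecidablePred p] [DecidablePred q], ∀ᵐ ω ∂P,
      (∀ᶠ n in atTop, Nat.count (fun i => q (M.label (X i ω))) n <
        Nat.count (fun i => p (M.label (X i ω))) n) →
      ∀ᶠ k in atTop,
        Nat.count (fun i => q (M.label (X (FreqMonitor.chunkStart k + 1 + i) ω))) (k + 2) <
          Nat.count (fun i => p (M.label (X (FreqMonitor.chunkStart k + 1 + i) ω))) (k + 2) := by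
    intro p q _ _
    -- Windows are indexed by their length `n`, and chunk `k` has length `k + 2`, hence the start
    -- `chunkStart (n - 2) + 1`; the lengths `0` and `1` are discarded below.
    filter_upwards [hX.ae_eventually_sum_pos_of_eventually_sum_pos hM
      (fun x => (if p (M.label x) then (1 : ℝ) else 0) - if q (M.label x) then 1 else 0)
      (fun n => FreqMonitor.chunkStart (n - 2) + 1)] with ω h hω
    simp only [FreqMonitor.sum_ite_sub_ite, sub_pos, Nat.cast_lt] at h
    exact (tendsto_add_atTop_nat 2).eventually (h hω)
  have h₁ : ∀ a : A, _ := fun a => key (fun σ => σ ≤ a) fun σ => a < σ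
  have h₂ : ∀ a : A, _ := fun a => key (fun σ => a ≤ σ) fun σ => σ < a
  filter_upwards [MeasureTheory.ae_all_iff.2 h₁, MeasureTheory.ae_all_iff.2 h₂] with ω h₁ h₂ a ha
  obtain ⟨N, hN⟩ := ha
  simp only [FreqMonitor.median_eq_some_iff, FreqMonitor.IsMedian,
    FreqMonitor.sum_count_pref] at hN
  exact FreqMonitor.medianMonitor_convergesTo
    ((h₁ a (eventually_atTop.2 ⟨N, fun n hn => (hN n hn).1⟩)).and
      (h₂ a (eventually_atTop.2 ⟨N, fun n hn => (hN n hn).2⟩)))
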